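/- Let $P$ be an $n\times n$ (entrywise) nonnegative real matrix, let $b\in\mathbb{R}^n$ with $b\ge 0$, and let $\lambda>0$ be a real number. Terminology. For $i,j\in\{1,\dots,n\}$, $i$ has access to $j$ if there is a path (possibly of length $0$) from $i$ to $j$ in the directed graph of $P$, which has an arc $k\to l$ exactly when $p_{kl}\ne 0$; a set $I$ has access to a set $J$ (and $J$ has access from $I$) if some $i\in I$ has access to some $j\in J$. The classes of $P$ are the equivalence classes of the relation of mutual access. For a class $\alpha$, $P_{\alpha\alpha}$ is the corresponding principal submatrix and $\rho(P_{\alpha\alpha})$ its spectral radius; $\alpha$ is distinguished if $\rho(P_{\beta\beta})<\rho(P_{\alpha\alpha})$ for every class $\beta\neq\alpha$ that has access to $\alpha$. A distinguished eigenvector of $P$ is an eigenvector $x\ge 0$, $x\neq 0$, of $P$, and its eigenvalue is called a distinguished eigenvalue. A generalized eigenvector of $P^T$ for an eigenvalue $\mu\in\mathbb{C}$ is a nonzero $z\in\mathbb{C}^n$ with $(P^T-\mu I)^kz=0$ for some $k\ge 1$; $|z|$ is the vector of the moduli of the components of $z$. The local spectral radius is $\rho_b(P)=\limsup_{m\to\infty}\|P^mb\|^{1/m}$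 for $b\ne 0$ and $\rho_0(P)=0$. Finally $\operatorname{supp}(x)=\{i: x_i\neq 0\}$. Then the following conditions are equivalent: (a) there is $x\in\mathbb{R}^n$, $x\ge 0$, with $(\lambda I-P)x=b$; (b) $\rho_b(P)<\lambda$; (c) $\lim_{m\to\infty}\sum_{j=0}^m\lambda^{-j}P^jb$ exists; (d) $\lim_{m\to\infty}(\lambda^{-1}P)^mb=0$; (e) $\langle z,b\rangle=0$ for each generalized eigenvector $z$ of $P^T$ corresponding to an eigenvalue with modulus $\ge\lambda$; (f) $\langle z,b\rangle=0$ for each generalized eigenvector $z$ of $P^T$ corresponding to a distinguished eigenvalue of $P$ which is $\ge\lambda$; (g) $\rho(P_{\alpha\alpha})<\lambda$ for every class $\alpha$ of $P$ having access to $\operatorname{supp}(b)$; (h) for each distinguished class $\alpha$ of $P$ with $\rho(P_{\alpha\alpha})\ge\lambda$, and each class $\beta$ that has access from $\alpha$, the subvector $b_\beta$ is $0$; (i) $\langle |z|,b\rangle=0$ for each generalized eigenvector $z$ of $P^T$ corresponding to an eigenvalue with modulus $\ge\lambda$; (j) $\langle |z|,b\rangle=0$ for each generalized eigenvector $z$ of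 $P^T$ corresponding to a distinguished eigenvalue of $P$ which is $\ge\lambda$. When these conditions hold, the series $x^0=\sum_{j=0}^\infty\lambda^{-j-1}P^jb$ converges, $x^0$ is a solution of $(\lambda I-P)x=b$, $x\ge 0$, its support equals the union of all classes of $P$ having access to $\operatorname{supp}(b)$, and $x^0$ is the only solution whose support is included in that union. In this case, if $\lambda$ is not a distinguished eigenvalue of $P$, then $x^0$ is the unique solution; and if $\lambda$ is a distinguished eigenvalue of $P$, then the solutions are precisely the vectors $x^0+u$, where $u$ is the zero vector or a distinguished eigenvector of $P$ corresponding to $\lambda$. -/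

import Mathlib

open Filter Topology
open scoped ENNReal Matrix

noncomputable section

namespace NonnegMatrix

/-- A real matrix regarded as a complex matrix. -/
abbrev toC {m : Type*} (A : Matrix m m ℝ) : Matrix m m ℂ := A.map Complex.ofReal

/-- A real vector regarded as a complex vector. -/
abbrev vecToC {m : Type*} (x : m → ℝ) : m → ℂ := fun i => (x i : ℂ)

/-- Spectral radius of a real square matrix: the largest modulus of its complex eigenvalues. -/
def rho {m : Type*} [Fintype m] [DecidableEq m] (A : Matrix m m ℝ) : ℝ≥0∞ :=
  spectralRadius ℂ (toC A)

/-- Local spectral radius of `A` at `x`: zero at `x = 0`, and otherwise the limit superior of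
`‖A ^ m x‖ ^ (1 / m)`. The norm is the sup norm; all norms on `ℂ ^ n` give the same value. -/
def localRho {n : ℕ} (A : Matrix (Fin n) (Fin n) ℂ) (x : Fin n → ℂ) : ℝ≥0∞ :=
  open Classical in
  if x = 0 then 0
  else limsup (fun m : ℕ => ‖(A ^ m) *ᵥ x‖ₑ ^ (1 / (m : ℝ))) atTop

/-- `z` is a generalized eigenvector of the complex matrix `A` for the eigenvalue `μ`:
`z ≠ 0` and `(A - μ I) ^ k z = 0` for some `k`. -/
def IsGenEigenvector {n : ℕ} (A : Matrix (Fin n) (Fin n) ℂ) (μ : ℂ) (z : Fin n → ℂ) : Prop :=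
  Module.End.HasUnifEigenvector (Matrix.toLin' A) μ ⊤ z

/-- A distinguished eigenvector of `P` for the nonnegative orthant, with eigenvalue `μ`. -/
def IsDistinguishedEigenvector {n : ℕ} (P : Matrix (Fin n) (Fin n) ℝ) (μ : ℝ)
    (x : Fin n → ℝ) : Prop :=
  0 ≤ x ∧ Module.End.HasEigenvector (Matrix.toLin' P) μ x

/-- A distinguished eigenvalue of `P` for the nonnegative orthant. -/
def IsDistinguishedEigenvalue {n : ℕ} (P : Matrix (Fin n) (Fin n) ℝ) (μ : ℝ) : Prop :=
  ∃ x : Fin n → ℝ, IsDistinguishedEigenvector P μ x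

/-- `i` has access to `j`: there is a (possibly trivial) path from `i` to `j` in the directed
graph of `P`, which has an arc from `k` to `l` exactly when `P k l ≠ 0`. -/
def Access {n : ℕ} (P : Matrix (Fin n) (Fin n) ℝ) (i j : Fin n) : Prop :=
  Relation.ReflTransGen (fun k l => P k l ≠ 0) i j

/-- Some element of `I` has access to some element of `J`. -/
def SetAccess {n : ℕ} (P : Matrix (Fin n) (Fin n) ℝ) (I J : Set (Fin n)) : Prop :=
  ∃ i ∈ I, ∃ j ∈ J, Access P i j

/-- A class of `P`: an equivalence class of the relation of mutual access. -/
def IsClass {n : ℕ} (P : Matrix (Fin n) (Fin n) ℝ) (α : Finset (Fin n)) : Prop :=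
  ∃ i, ∀ j, j ∈ α ↔ (Access P i j ∧ Access P j i)

/-- The spectral radius of the principal submatrix of `P` indexed by `α`. -/
def classRho {n : ℕ} (P : Matrix (Fin n) (Fin n) ℝ) (α : Finset (Fin n)) : ℝ≥0∞ :=
  rho (P.submatrix (Subtype.val : {i // i ∈ α} → Fin n) (Subtype.val : {i // i ∈ α} → Fin n))

/-- A distinguished class: every other class with access to it has a strictly smaller
spectral radius. -/
def IsDistinguishedClass {n : ℕ} (P : Matrix (Fin n) (Fin n) ℝ) (α : Finset (Fin n)) : Prop :=
  IsClass P α ∧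
    ∀ β : Finset (Fin n), IsClass P β → β ≠ α → SetAccess P β α → classRho P β < classRho P α

/-- The union of all classes of `P` that have access to `J`. -/
def accessUnion {n : ℕ} (P : Matrix (Fin n) (Fin n) ℝ) (J : Set (Fin n)) : Set (Fin n) :=
  {i | ∃ α : Finset (Fin n), IsClass P α ∧ SetAccess P α J ∧ i ∈ α}

/-- `x` solves `(lam I - P) x = b`, `x ≥ 0`. -/
def IsSolution {n : ℕ} (P : Matrix (Fin n) (Fin n) ℝ) (lam : ℝ) (b x : Fin n → ℝ) : Prop :=
  0 ≤ x ∧ (lam • (1 : Matrix (Fin n) (Fin n) ℝ) - P) *ᵥ x = b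

end NonnegMatrix

end

open NonnegMatrix

namespace NonnegMatrix

/-! ### Powers of a nonnegative matrix -/

variable {n : ℕ} {P : Matrix (Fin n) (Fin n) ℝ} {b : Fin n → ℝ} {lam : ℝ}

/-! The map `w ↦ lam⁻¹ • (P *ᵥ w + b)` is monotone, and its iterates from `0` are the partial sums
of the Neumann series. Any nonnegative supersolution bounds them, so solvability means convergence
of the series, whose sum is the least solution.

Two facts carry the equivalences. If `lam` is solvable, a finite sum of the vectors `lam⁻ᵐ Pᵐ x` is
a vector `y ≥ b` with `P *ᵥ y ≤ s • y` for some `s < lam` (`IsSolution.exists_contracting`). This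
strict gap gives the bounds on the local spectral radius and on the class spectral radii. If `lam`
is not solvable, rescaled solutions at parameters decreasing to the critical value `r ≥ lam`
converge to a nonnegative eigenvector for `r`, which lies in every invariant subspace containing `b`
(`exists_eigenvector_of_not_solvable`).

Two choices of subspace refute non-solvability. The range of a high power of `P - r` contradicts
(f), since it meets the generalized eigenspace trivially. The vectors supported on indices with
access to the support of `b` contradict (g), since a final class in the support of the eigenvector
has `r` as an eigenvalue. -/

theorem mulVec_mono (hP : ∀ i j, 0 ≤ P i j) {x y : Fin n → ℝ} (h : x ≤ y) :
    P *ᵥ x ≤ P *ᵥ y := fun i => by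
  simp only [Matrix.mulVec, dotProduct]
  exact Finset.sum_le_sum fun j _ => mul_le_mul_of_nonneg_left (h j) (hP i j)

theorem mulVec_nonneg (hP : ∀ i j, 0 ≤ P i j) {x : Fin n → ℝ} (h : 0 ≤ x) : 0 ≤ P *ᵥ x := by
  simpa using mulVec_mono hP h

theorem pow_entry_nonneg (hP : ∀ i j, 0 ≤ P i j) (m : ℕ) (i j : Fin n) : 0 ≤ (P ^ m) i j := by
  induction m generalizing i j with
  | zero => rw [pow_zero, Matrix.one_apply]; split_ifs <;> norm_num
  | succ m ih =>
    rw [pow_succ, Matrix.mul_apply]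
    exact Finset.sum_nonneg fun k _ => mul_nonneg (ih i k) (hP k j)

theorem pow_succ_mulVec (m : ℕ) (x : Fin n → ℝ) : (P ^ (m + 1)) *ᵥ x = P *ᵥ ((P ^ m) *ᵥ x) := by
  rw [Matrix.mulVec_mulVec, pow_succ']

theorem pow_mulVec_le (hP : ∀ i j, 0 ≤ P i j) {c : ℝ} (hc : 0 ≤ c) {y : Fin n → ℝ}
    (h : P *ᵥ y ≤ c • y) (m : ℕ) : (P ^ m) *ᵥ y ≤ c ^ m • y := by
  induction m with
  | zero => simp
  | succ m ih =>
    rw [pow_succ_mulVec]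
    refine (mulVec_mono hP ih).trans ?_
    rw [Matrix.mulVec_smul, pow_succ, mul_smul]
    exact smul_le_smul_of_nonneg_left h (pow_nonneg hc m)

theorem le_pow_mulVec (hP : ∀ i j, 0 ≤ P i j) {c : ℝ} (hc : 0 ≤ c) {y : Fin n → ℝ}
    (h : c • y ≤ P *ᵥ y) (m : ℕ) : c ^ m • y ≤ (P ^ m) *ᵥ y := by
  induction m with
  | zero => simp
  | succ m ih =>
    rw [pow_succ_mulVec]
    refine le_trans ?_ (mulVec_mono hP ih)
    rw [Matrix.mulVec_smul, pow_succ, mul_smul]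
    exact smul_le_smul_of_nonneg_left h (pow_nonneg hc m)

/-! ### Neumann series and the least solution -/

theorem isSolution_iff {x : Fin n → ℝ} :
    IsSolution P lam b x ↔ 0 ≤ x ∧ P *ᵥ x + b = lam • x := by
  unfold IsSolution
  rw [Matrix.sub_mulVec, Matrix.smul_mulVec, Matrix.one_mulVec, sub_eq_iff_eq_add', eq_comm]

/-- The terms of the Neumann series of `(lam I - P)⁻¹ b`. -/
noncomputable def neumannTerm (P : Matrix (Fin n) (Fin n) ℝ) (lam : ℝ) (b : Fin n → ℝ) (j : ℕ) : Fin n → ℝ :=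
  (lam ^ (j + 1))⁻¹ • ((P ^ j) *ᵥ b)

theorem neumannTerm_nonneg (hP : ∀ i j, 0 ≤ P i j) (hb : 0 ≤ b) (hlam : 0 < lam) (j : ℕ) :
    0 ≤ neumannTerm P lam b j :=
  smul_nonneg (by positivity) (mulVec_nonneg (pow_entry_nonneg hP j) hb)

theorem neumannTerm_succ (j : ℕ) :
    neumannTerm P lam b (j + 1) = lam⁻¹ • (P *ᵥ neumannTerm P lam b j) := by
  unfold neumannTerm
  rw [pow_succ_mulVec, Matrix.mulVec_smul, smul_smul, pow_succ lam (j + 1), mul_inv, mul_comm]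

theorem sum_neumannTerm_succ (m : ℕ) :
    ∑ j ∈ Finset.range (m + 1), neumannTerm P lam b j
      = lam⁻¹ • (P *ᵥ (∑ j ∈ Finset.range m, neumannTerm P lam b j) + b) := by
  rw [Finset.sum_range_succ', Matrix.mulVec_sum, smul_add, Finset.smul_sum]
  simp only [neumannTerm_succ]
  congr 1
  simp [neumannTerm]

theorem sum_neumannTerm_le (hP : ∀ i j, 0 ≤ P i j) (hlam : 0 < lam) {y : Fin n → ℝ}
    (hy : 0 ≤ y) (h : P *ᵥ y + b ≤ lam • y) (m : ℕ) :
    ∑ j ∈ Finset.range m, neumannTerm P lam b j ≤ y := by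
  induction m with
  | zero => simpa using hy
  | succ m ih =>
    rw [sum_neumannTerm_succ]
    calc lam⁻¹ • (P *ᵥ (∑ j ∈ Finset.range m, neumannTerm P lam b j) + b)
        ≤ lam⁻¹ • (P *ᵥ y + b) :=
          smul_le_smul_of_nonneg_left (add_le_add_left (mulVec_mono hP ih) b) (by positivity)
      _ ≤ lam⁻¹ • (lam • y) := smul_le_smul_of_nonneg_left h (by positivity)
      _ = y := inv_smul_smul₀ hlam.ne' y

theorem isSolution_of_hasSum (hP : ∀ i j, 0 ≤ P i j) (hb : 0 ≤ b) (hlam : 0 < lam)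
    {x : Fin n → ℝ} (hx : HasSum (neumannTerm P lam b) x) : IsSolution P lam b x := by
  rw [isSolution_iff]
  refine ⟨hasSum_le (fun j => neumannTerm_nonneg hP hb hlam j) hasSum_zero hx, ?_⟩
  have h1 := hx.tendsto_sum_nat
  have h2 := (tendsto_add_atTop_iff_nat 1).2 h1
  simp only [sum_neumannTerm_succ] at h2
  have hc : Continuous fun w : Fin n → ℝ => lam⁻¹ • (P *ᵥ w + b) := by fun_prop
  have h3 := tendsto_nhds_unique h2 ((hc.tendsto x).comp h1)
  nth_rw 2 [h3]
  rw [smul_inv_smul₀ hlam.ne']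

/-- A nonnegative supersolution dominates the sum of the Neumann series. -/
theorem exists_hasSum_of_supersolution (hP : ∀ i j, 0 ≤ P i j) (hb : 0 ≤ b) (hlam : 0 < lam)
    {y : Fin n → ℝ} (hy : 0 ≤ y) (h : P *ᵥ y + b ≤ lam • y) :
    ∃ x, HasSum (neumannTerm P lam b) x ∧ x ≤ y := by
  have hs : Summable (neumannTerm P lam b) := by
    rw [Pi.summable]
    intro i
    refine summable_of_sum_range_le (c := y i)
      (fun j => neumannTerm_nonneg hP hb hlam j i) fun m => ?_
    have := sum_neumannTerm_le hP hlam hy h m i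
    rwa [Finset.sum_apply] at this
  refine ⟨_, hs.hasSum, le_of_tendsto' hs.hasSum.tendsto_sum_nat fun m => ?_⟩
  exact sum_neumannTerm_le hP hlam hy h m

theorem IsSolution.exists_hasSum (hP : ∀ i j, 0 ≤ P i j) (hb : 0 ≤ b) (hlam : 0 < lam)
    {y : Fin n → ℝ} (h : IsSolution P lam b y) :
    ∃ x, HasSum (neumannTerm P lam b) x ∧ x ≤ y :=
  exists_hasSum_of_supersolution hP hb hlam h.1 (isSolution_iff.1 h).2.le

theorem exists_isSolution_of_supersolution (hP : ∀ i j, 0 ≤ P i j) (hb : 0 ≤ b) (hlam : 0 < lam)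
    {y : Fin n → ℝ} (hy : 0 ≤ y) (h : P *ᵥ y + b ≤ lam • y) : ∃ x, IsSolution P lam b x := by
  obtain ⟨x, hx, -⟩ := exists_hasSum_of_supersolution hP hb hlam hy h
  exact ⟨x, isSolution_of_hasSum hP hb hlam hx⟩

/-- Iterating `x = lam⁻¹ • (P *ᵥ x + b)` leaves an explicit remainder; for the least solution it is
the tail of the series and tends to zero. -/
theorem IsSolution.sum_add (hlam : 0 < lam) {x : Fin n → ℝ} (h : IsSolution P lam b x) (m : ℕ) :
    ∑ j ∈ Finset.range m, neumannTerm P lam b j + (lam ^ m)⁻¹ • ((P ^ m) *ᵥ x) = x := by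
  induction m with
  | zero => simp
  | succ m ih =>
    conv_rhs => rw [← ih]
    have h2 : x = lam⁻¹ • (P *ᵥ x + b) := by
      rw [(isSolution_iff.1 h).2, inv_smul_smul₀ hlam.ne']
    have h3 : (P ^ m) *ᵥ x = lam⁻¹ • ((P ^ (m + 1)) *ᵥ x + (P ^ m) *ᵥ b) := by
      conv_lhs => rw [h2]
      rw [Matrix.mulVec_smul, Matrix.mulVec_add, Matrix.mulVec_mulVec, ← pow_succ]
    rw [Finset.sum_range_succ, add_assoc, h3, smul_smul, ← mul_inv, ← pow_succ, smul_add, neumannTerm,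
      add_comm ((lam ^ (m + 1))⁻¹ • (P ^ m *ᵥ b))]

theorem tendsto_pow_mulVec_of_hasSum (hP : ∀ i j, 0 ≤ P i j) (hb : 0 ≤ b) (hlam : 0 < lam)
    {x : Fin n → ℝ} (hx : HasSum (neumannTerm P lam b) x) :
    Tendsto (fun m : ℕ => (lam ^ m)⁻¹ • ((P ^ m) *ᵥ x)) atTop (𝓝 0) := by
  have h := isSolution_of_hasSum hP hb hlam hx
  have h1 := hx.tendsto_sum_nat.const_sub x
  rw [sub_self] at h1
  refine h1.congr fun m => ?_
  nth_rw 1 [← h.sum_add hlam m]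
  rw [add_sub_cancel_left]

/-- Solvability for `lam` yields a nonnegative vector dominating `b` on which `P` acts with a
growth factor strictly below `lam`. -/
theorem IsSolution.exists_contracting (hP : ∀ i j, 0 ≤ P i j) (hb : 0 ≤ b) (hlam : 0 < lam)
    {x : Fin n → ℝ} (h : IsSolution P lam b x) :
    ∃ (s : ℝ) (y : Fin n → ℝ), 0 < s ∧ s < lam ∧ 0 ≤ y ∧ b ≤ y ∧ P *ᵥ y ≤ s • y := by
  obtain ⟨x, hx, -⟩ := h.exists_hasSum hP hb hlam
  replace h := isSolution_of_hasSum hP hb hlam hx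
  have hx0 : 0 ≤ x := h.1
  set B : ℕ → Fin n → ℝ := fun m => (lam ^ m)⁻¹ • ((P ^ m) *ᵥ x) with hB
  have hB0 : B 0 = x := by simp [hB]
  have hPB : ∀ m, P *ᵥ B m = lam • B (m + 1) := by
    intro m
    simp only [hB]
    rw [Matrix.mulVec_smul, ← pow_succ_mulVec, smul_smul, pow_succ lam m, mul_inv,
      mul_comm, mul_assoc, inv_mul_cancel₀ hlam.ne', mul_one]
  have hBnn : ∀ m, 0 ≤ B m := fun m =>
    smul_nonneg (by positivity) (mulVec_nonneg (pow_entry_nonneg hP m) hx0)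
  have hBx : ∀ m, B m ≤ x := by
    intro m
    have := h.sum_add hlam m
    conv_rhs => rw [← this]
    exact le_add_of_nonneg_left (Finset.sum_nonneg fun j _ => neumannTerm_nonneg hP hb hlam j)
  have hlim : Tendsto B atTop (𝓝 0) := tendsto_pow_mulVec_of_hasSum hP hb hlam hx
  -- Coordinates where `x` vanishes need separate care: there `B m ≤ x` already forces the bound,
  -- while elsewhere it follows from `B m → 0`.
  have hev : ∀ᶠ m in atTop, ∀ i, B m i ≤ x i / 2 := by
    rw [eventually_all]
    intro i
    rcases (hx0 i).eq_or_lt with h0 | h0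
    · refine Eventually.of_forall fun m => ?_
      have h1 := hBx m i
      simp only [Pi.zero_apply] at h0
      linarith
    · have := (tendsto_pi_nhds.1 hlim i).eventually_le_const (half_pos h0)
      exact this
  obtain ⟨M, hM, hM1⟩ := (hev.and (eventually_ge_atTop 1)).exists
  have hMpos : (0 : ℝ) < M := by exact_mod_cast hM1
  have hM1' : (1 : ℝ) ≤ M := by exact_mod_cast hM1
  set y : Fin n → ℝ := ∑ k ∈ Finset.range M, B k with hy
  have hxy : x ≤ y := by
    rw [← hB0]
    exact Finset.single_le_sum (f := B) (fun k _ => hBnn k) (Finset.mem_range.2 hM1)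
  have hyM : ∀ i, y i ≤ M * x i := by
    intro i
    rw [hy, Finset.sum_apply]
    refine (Finset.sum_le_sum (fun k _ => hBx k i)).trans ?_
    simp
  -- `P` shifts the sequence `B` up to the factor `lam`, so the sum telescopes.
  have hPy : P *ᵥ y = lam • (y - x + B M) := by
    rw [hy, Matrix.mulVec_sum]
    simp only [hPB]
    rw [← Finset.smul_sum]
    congr 1
    have h1 := Finset.sum_range_succ B M
    have h2 := Finset.sum_range_succ' B M
    rw [h1, hB0] at h2
    rw [sub_add_eq_add_sub, h2, add_sub_cancel_right]
  have hε : 1 / (2 * (M : ℝ)) ≤ 1 / 2 := by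
    apply one_div_le_one_div_of_le <;> linarith
  have hε0 : 0 < 1 / (2 * (M : ℝ)) := by positivity
  have hbx : b ≤ lam • x := by
    rw [← (isSolution_iff.1 h).2]
    exact le_add_of_nonneg_left (mulVec_nonneg hP hx0)
  -- From `B M ≤ x / 2` and `y ≤ M x`, the net loss `x - B M` is at least `x / 2 ≥ y / (2M)`; this
  -- fixes the growth factor. Scaling `y` by `lam` makes it dominate `b`.
  refine ⟨lam * (1 - 1 / (2 * M)), lam • y, mul_pos hlam (by linarith),
    by nlinarith, smul_nonneg hlam.le (hx0.trans hxy),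
    hbx.trans (smul_le_smul_of_nonneg_left hxy hlam.le), ?_⟩
  rw [Matrix.mulVec_smul, hPy, mul_smul, smul_comm _ lam y]
  refine smul_le_smul_of_nonneg_left (smul_le_smul_of_nonneg_left ?_ hlam.le) hlam.le
  intro i
  have h1 := hM i
  have h2 := hyM i
  have h3 : 1 / (2 * (M : ℝ)) * y i ≤ x i / 2 := by
    rw [div_mul_eq_mul_div, one_mul, div_le_div_iff₀ (by positivity) (by norm_num)]
    linarith
  simp only [Pi.add_apply, Pi.sub_apply, Pi.smul_apply, smul_eq_mul]
  linarith

theorem pow_mulVec_le_of_contracting (hP : ∀ i j, 0 ≤ P i j) {s C : ℝ} (hs : 0 ≤ s)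
    {w y : Fin n → ℝ} (h : P *ᵥ y ≤ s • y) (hw : w ≤ C • y) (hC : 0 ≤ C) (m : ℕ) :
    (P ^ m) *ᵥ w ≤ (C * s ^ m) • y := by
  refine (mulVec_mono (pow_entry_nonneg hP m) hw).trans ?_
  rw [Matrix.mulVec_smul, mul_smul]
  exact smul_le_smul_of_nonneg_left (pow_mulVec_le hP hs h m) hC

theorem pow_mulVec_mem {W : Submodule ℝ (Fin n → ℝ)} (hW : ∀ w ∈ W, P *ᵥ w ∈ W) {w : Fin n → ℝ}
    (hw : w ∈ W) (m : ℕ) : (P ^ m) *ᵥ w ∈ W := by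
  induction m with
  | zero => simpa using hw
  | succ m ih => rw [pow_succ_mulVec]; exact hW _ ih

theorem mem_of_hasSum_neumannTerm {W : Submodule ℝ (Fin n → ℝ)} (hW : ∀ w ∈ W, P *ᵥ w ∈ W)
    (hbW : b ∈ W) {x : Fin n → ℝ} (hx : HasSum (neumannTerm P lam b) x) : x ∈ W := by
  have hc : IsClosed (W : Set (Fin n → ℝ)) := Submodule.closed_of_finiteDimensional W
  refine hc.mem_of_tendsto hx.tendsto_sum_nat (Eventually.of_forall fun m => ?_)
  exact W.sum_mem fun j _ => W.smul_mem _ (pow_mulVec_mem hW hbW j)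

/-! ### The critical parameter and its eigenvector -/

theorem IsSolution.exists_isSolution_of_le (hP : ∀ i j, 0 ≤ P i j) (hb : 0 ≤ b) (hlam : 0 < lam)
    {x : Fin n → ℝ} (h : IsSolution P lam b x) {s : ℝ} (hs : lam ≤ s) :
    ∃ x, IsSolution P s b x := by
  refine exists_isSolution_of_supersolution hP hb (hlam.trans_le hs) h.1 ?_
  rw [(isSolution_iff.1 h).2]
  exact smul_le_smul_of_nonneg_right hs h.1

/-- For `t` strictly between the contraction factor `s` and `lam`, the vector `(t - s)⁻¹ • y` is a
supersolution at `t`. Hence the infimum of the solvable parameters is not attained. -/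
theorem IsSolution.exists_isSolution_lt (hP : ∀ i j, 0 ≤ P i j) (hb : 0 ≤ b) (hlam : 0 < lam)
    {x : Fin n → ℝ} (h : IsSolution P lam b x) :
    ∃ s, 0 < s ∧ s < lam ∧ ∃ x, IsSolution P s b x := by
  obtain ⟨s, y, hs, hsl, hy, hby, hPy⟩ := h.exists_contracting hP hb hlam
  obtain ⟨t, hst, htl⟩ := exists_between hsl
  have hts : 0 < t - s := sub_pos.2 hst
  refine ⟨t, hs.trans hst, htl, exists_isSolution_of_supersolution hP hb (hs.trans hst)
    (y := (t - s)⁻¹ • y) (smul_nonneg (by positivity) hy) ?_⟩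
  rw [Matrix.mulVec_smul]
  calc (t - s)⁻¹ • (P *ᵥ y) + b ≤ (t - s)⁻¹ • (s • y) + y :=
        add_le_add (smul_le_smul_of_nonneg_left hPy (by positivity)) hby
    _ = t • (t - s)⁻¹ • y := by
        ext i
        simp only [Pi.add_apply, Pi.smul_apply, smul_eq_mul]
        field_simp
        ring

theorem exists_isSolution_of_large (hP : ∀ i j, 0 ≤ P i j) (hb : 0 ≤ b) :
    ∃ s, 0 < s ∧ ∃ x, IsSolution P s b x := by
  set K : ℝ := ∑ i, ∑ j, P i j with hK
  have hK0 : 0 ≤ K := Finset.sum_nonneg fun i _ => Finset.sum_nonneg fun j _ => hP i j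
  refine ⟨K + 1, by linarith, exists_isSolution_of_supersolution hP hb (by linarith)
    (y := fun _ => ‖b‖) (fun _ => norm_nonneg _) fun i => ?_⟩
  have h1 : ∑ j, P i j ≤ K := Finset.single_le_sum (f := fun i => ∑ j, P i j)
    (fun i _ => Finset.sum_nonneg fun j _ => hP i j) (Finset.mem_univ i)
  have h2 : b i ≤ ‖b‖ := (le_abs_self _).trans (norm_le_pi_norm b i)
  simp only [Pi.add_apply, Pi.smul_apply, smul_eq_mul, Matrix.mulVec, dotProduct]
  rw [← Finset.sum_mul]
  nlinarith [norm_nonneg b]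

/-- If the equation is not solvable at `lam`, then some `r ≥ lam` is a distinguished eigenvalue,
with an eigenvector in every invariant subspace that contains `b`. -/
theorem exists_eigenvector_of_not_solvable (hP : ∀ i j, 0 ≤ P i j) (hb : 0 ≤ b) (hlam : 0 < lam)
    (hno : ¬ ∃ x, IsSolution P lam b x) :
    ∃ (r : ℝ) (x : Fin n → ℝ), lam ≤ r ∧ 0 ≤ x ∧ x ≠ 0 ∧ P *ᵥ x = r • x ∧
      ∀ W : Submodule ℝ (Fin n → ℝ), (∀ w ∈ W, P *ᵥ w ∈ W) → b ∈ W → x ∈ W := by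
  set S : Set ℝ := {s | 0 < s ∧ ∃ x, IsSolution P s b x} with hS
  have hSne : S.Nonempty := exists_isSolution_of_large hP hb
  have hSlam : ∀ s ∈ S, lam ≤ s := by
    rintro s ⟨hs, x, hx⟩
    by_contra! hlt
    exact hno (hx.exists_isSolution_of_le hP hb hs hlt.le)
  have hSbdd : BddBelow S := ⟨lam, hSlam⟩
  set r := sInf S with hr
  have hlr : lam ≤ r := le_csInf hSne hSlam
  have hr0 : 0 < r := hlam.trans_le hlr
  have hrS : ¬ ∃ x, IsSolution P r b x := by
    rintro ⟨x, hx⟩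
    obtain ⟨s, hs, hsr, hx'⟩ := hx.exists_isSolution_lt hP hb hr0
    exact hsr.not_ge (csInf_le hSbdd ⟨hs, hx'⟩)
  obtain ⟨s, -, hsr, hsS⟩ := exists_seq_tendsto_sInf hSne hSbdd
  have hx : ∀ k, ∃ x, HasSum (neumannTerm P (s k) b) x := fun k => by
    obtain ⟨h0, y, hy⟩ := hsS k
    obtain ⟨x, hx, -⟩ := hy.exists_hasSum hP hb h0
    exact ⟨x, hx⟩
  choose x hx using hx
  have hsol : ∀ k, IsSolution P (s k) b (x k) := fun k =>
    isSolution_of_hasSum hP hb (hsS k).1 (hx k)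
  -- The solutions `x k` may be unbounded. The pairs `(t k • x k, t k)` have norms adding up to one,
  -- so they stay in a compact set and cannot tend to zero.
  set t : ℕ → ℝ := fun k => (1 + ‖x k‖)⁻¹ with ht
  have hpos : ∀ k, 0 < 1 + ‖x k‖ := fun k => by positivity
  have ht0 : ∀ k, 0 ≤ t k := fun k => (inv_pos.2 (hpos k)).le
  have hnorm : ∀ k, ‖t k • x k‖ + t k = 1 := by
    intro k
    rw [norm_smul, Real.norm_of_nonneg (ht0 k)]
    have := inv_mul_cancel₀ (hpos k).ne'
    simp only [ht]
    linarith
  have hmem : ∀ k, ((t k • x k, t k) : (Fin n → ℝ) × ℝ) ∈ Metric.closedBall 0 1 := by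
    intro k
    rw [mem_closedBall_zero_iff, Prod.norm_def]
    refine max_le ?_ ?_
    · linarith [hnorm k, ht0 k]
    · rw [Real.norm_of_nonneg (ht0 k)]
      linarith [hnorm k, norm_nonneg (t k • x k)]
  obtain ⟨⟨x', t'⟩, -, φ, hφ, hlim⟩ :=
    (isCompact_closedBall (0 : (Fin n → ℝ) × ℝ) 1).tendsto_subseq hmem
  have hX : Tendsto (fun k => t (φ k) • x (φ k)) atTop (𝓝 x') := (Prod.tendsto_iff _ _).1 hlim |>.1
  have hT : Tendsto (fun k => t (φ k)) atTop (𝓝 t') := (Prod.tendsto_iff _ _).1 hlim |>.2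
  have hx'0 : 0 ≤ x' := ge_of_tendsto' hX fun k => smul_nonneg (ht0 _) (hsol _).1
  have ht'0 : 0 ≤ t' := ge_of_tendsto' hT fun k => ht0 _
  have hn' : ‖x'‖ + t' = 1 := by
    refine tendsto_nhds_unique (hX.norm.add hT) ?_
    simp only [hnorm]
    exact tendsto_const_nhds
  have heq : P *ᵥ x' + t' • b = r • x' := by
    have hc : Continuous fun w : Fin n → ℝ => P *ᵥ w := by fun_prop
    have h1 := ((hc.tendsto x').comp hX).add (hT.smul_const b)
    have h2 := (hsr.comp hφ.tendsto_atTop).smul hX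
    refine tendsto_nhds_unique h1 (h2.congr fun k => ?_)
    simp only [Function.comp_apply]
    rw [Matrix.mulVec_smul, ← smul_add, (isSolution_iff.1 (hsol (φ k))).2, smul_comm]
  -- Otherwise `t'⁻¹ • x'` would be a solution at the unsolvable parameter `r`.
  have ht'z : t' = 0 := by
    by_contra hne
    have htp : 0 < t' := lt_of_le_of_ne ht'0 (Ne.symm hne)
    refine hrS ⟨t'⁻¹ • x', isSolution_iff.2 ⟨smul_nonneg (by positivity) hx'0, ?_⟩⟩
    rw [Matrix.mulVec_smul, smul_comm r, ← heq, smul_add, inv_smul_smul₀ hne]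
  refine ⟨r, x', hlr, hx'0, ?_, ?_, fun W hW hbW => ?_⟩
  · rintro rfl
    simp [ht'z] at hn'
  · simpa [ht'z] using heq
  · have hc : IsClosed (W : Set (Fin n → ℝ)) := Submodule.closed_of_finiteDimensional W
    exact hc.mem_of_tendsto hX (Eventually.of_forall fun k =>
      W.smul_mem _ (mem_of_hasSum_neumannTerm hW hbW (hx (φ k))))

/-! ### Access, classes and supports -/

section Access

variable {i j : Fin n} {J : Set (Fin n)}

open Classical in
/-- The class of `P` containing `i`. -/
noncomputable def classOf (P : Matrix (Fin n) (Fin n) ℝ) (i : Fin n) : Finset (Fin n) :=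
  Finset.univ.filter fun j => Access P i j ∧ Access P j i

theorem mem_classOf : j ∈ classOf P i ↔ Access P i j ∧ Access P j i := by
  simp [classOf]

theorem self_mem_classOf : i ∈ classOf P i := mem_classOf.2 ⟨.refl, .refl⟩

theorem isClass_classOf : IsClass P (classOf P i) := ⟨i, fun _ => mem_classOf⟩

theorem IsClass.eq_classOf {α : Finset (Fin n)} (h : IsClass P α) (hi : i ∈ α) :
    α = classOf P i := by
  obtain ⟨k, hk⟩ := h
  obtain ⟨h1, h2⟩ := (hk i).1 hi
  ext j
  rw [hk, mem_classOf]
  exact ⟨fun h => ⟨h2.trans h.1, h.2.trans h1⟩, fun h => ⟨h1.trans h.1, h.2.trans h2⟩⟩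

theorem IsClass.access {α : Finset (Fin n)} (h : IsClass P α) (hi : i ∈ α) (hj : j ∈ α) :
    Access P i j := by
  rw [h.eq_classOf hi, mem_classOf] at hj
  exact hj.1

theorem IsClass.exists_eq_classOf {α : Finset (Fin n)} (h : IsClass P α) :
    ∃ i, α = classOf P i := by
  obtain ⟨i, hi⟩ := h
  exact ⟨i, Finset.ext fun j => (hi j).trans mem_classOf.symm⟩

theorem setAccess_classOf : SetAccess P (classOf P i) J ↔ ∃ j ∈ J, Access P i j := by
  constructor
  · rintro ⟨k, hk, j, hj, h⟩
    exact ⟨j, hj, (mem_classOf.1 hk).1.trans h⟩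
  · rintro ⟨j, hj, h⟩
    exact ⟨i, self_mem_classOf, j, hj, h⟩

theorem setAccess_classOf_classOf :
    SetAccess P (classOf P i) (classOf P j) ↔ Access P i j := by
  rw [setAccess_classOf]
  exact ⟨fun ⟨k, hk, h⟩ => h.trans (mem_classOf.1 hk).2, fun h => ⟨j, self_mem_classOf, h⟩⟩

theorem mem_accessUnion : i ∈ accessUnion P J ↔ ∃ j ∈ J, Access P i j := by
  constructor
  · rintro ⟨α, hα, hJ, hi⟩
    rw [hα.eq_classOf hi, setAccess_classOf] at hJ
    exact hJ
  · intro h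
    exact ⟨classOf P i, isClass_classOf, setAccess_classOf.2 h, self_mem_classOf⟩

theorem mem_accessUnion_of_access (h : Access P i j) (hj : j ∈ accessUnion P J) :
    i ∈ accessUnion P J := by
  obtain ⟨k, hk, hjk⟩ := mem_accessUnion.1 hj
  exact mem_accessUnion.2 ⟨k, hk, h.trans hjk⟩

theorem mem_accessUnion_self (hi : i ∈ J) : i ∈ accessUnion P J :=
  mem_accessUnion.2 ⟨i, hi, .refl⟩

/-- Vectors whose support lies in the set of indices with access to `J`. -/
def accessSubmodule (P : Matrix (Fin n) (Fin n) ℝ) (J : Set (Fin n)) :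
    Submodule ℝ (Fin n → ℝ) where
  carrier := {w | ∀ i ∉ accessUnion P J, w i = 0}
  add_mem' hv hw i hi := by simp [hv i hi, hw i hi]
  zero_mem' _ _ := rfl
  smul_mem' c w hw i hi := by simp [hw i hi]

theorem mulVec_mem_accessSubmodule {w : Fin n → ℝ} (hw : w ∈ accessSubmodule P J) :
    P *ᵥ w ∈ accessSubmodule P J := by
  intro i hi
  simp only [Matrix.mulVec, dotProduct]
  refine Finset.sum_eq_zero fun j _ => ?_
  by_cases hj : j ∈ accessUnion P J
  · have : P i j = 0 := by
      by_contra hne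
      exact hi (mem_accessUnion_of_access (.single hne) hj)
    simp [this]
  · simp [hw j hj]

theorem mem_accessSubmodule_support : b ∈ accessSubmodule P (Function.support b) := by
  intro i hi
  by_contra hne
  exact hi (mem_accessUnion_self hne)

theorem exists_pow_pos_of_access (hP : ∀ i j, 0 ≤ P i j) (h : Access P i j) :
    ∃ k, 0 < (P ^ k) i j := by
  induction h using Relation.ReflTransGen.head_induction_on with
  | refl => exact ⟨0, by simp⟩
  | head hac _ ih =>
    obtain ⟨k, hk⟩ := ih
    refine ⟨k + 1, ?_⟩
    rw [pow_succ', Matrix.mul_apply]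
    refine (mul_pos (lt_of_le_of_ne (hP _ _) (Ne.symm hac)) hk).trans_le ?_
    exact Finset.single_le_sum (f := fun l => P _ l * (P ^ k) l j)
      (fun l _ => mul_nonneg (hP _ _) (pow_entry_nonneg hP k _ _)) (Finset.mem_univ _)

/-- Positivity of a subinvariant vector propagates backwards along each arc. -/
theorem pos_of_access (hP : ∀ i j, 0 ≤ P i j) {s : ℝ} (hs : 0 < s) {y : Fin n → ℝ} (hy : 0 ≤ y)
    (h : P *ᵥ y ≤ s • y) (hij : Access P i j) (hj : 0 < y j) : 0 < y i := by
  induction hij using Relation.ReflTransGen.head_induction_on with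
  | refl => exact hj
  | @head a c hac _ ih =>
    have h1 : P a c * y c ≤ (P *ᵥ y) a :=
      Finset.single_le_sum (f := fun l => P a l * y l)
        (fun l _ => mul_nonneg (hP _ _) (hy l)) (Finset.mem_univ c)
    have h2 : 0 < P a c * y c := mul_pos (lt_of_le_of_ne (hP _ _) (Ne.symm hac)) ih
    exact pos_of_mul_pos_right (h2.trans_le (h1.trans (h a))) hs.le

theorem pos_of_mem_accessUnion (hP : ∀ i j, 0 ≤ P i j) (hb : 0 ≤ b) {s C : ℝ} (hs : 0 < s)
    {y : Fin n → ℝ} (hy : 0 ≤ y) (h : P *ᵥ y ≤ s • y) (hC : 0 ≤ C) (hby : b ≤ C • y)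
    (hi : i ∈ accessUnion P (Function.support b)) : 0 < y i := by
  obtain ⟨j, hj, hij⟩ := mem_accessUnion.1 hi
  have hbj : 0 < b j := lt_of_le_of_ne (hb j) (Ne.symm hj)
  exact pos_of_access hP hs hy h hij (pos_of_mul_pos_right (hbj.trans_le (hby j)) hC)

/-- A vector is dominated by a multiple of `y` if `y` is positive wherever the vector is
nonzero. -/
theorem exists_le_smul {x y : Fin n → ℝ} (hy : 0 ≤ y) (h : ∀ i, x i ≠ 0 → 0 < y i) :
    ∃ C : ℝ, 0 ≤ C ∧ x ≤ C • y := by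
  have hnn : ∀ i, 0 ≤ |x i| / y i := fun i => div_nonneg (abs_nonneg _) (hy i)
  refine ⟨∑ i, |x i| / y i, Finset.sum_nonneg fun i _ => hnn i, fun i => ?_⟩
  by_cases hx : x i = 0
  · rw [hx]
    exact mul_nonneg (Finset.sum_nonneg fun i _ => hnn i) (hy i)
  · have h1 := Finset.single_le_sum (f := fun i => |x i| / y i) (fun i _ => hnn i)
      (Finset.mem_univ i)
    calc x i ≤ |x i| / y i * y i := by
          rw [div_mul_cancel₀ _ (h i hx).ne']; exact le_abs_self _
      _ ≤ _ := mul_le_mul_of_nonneg_right h1 (hy i)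

end Access

/-! ### Passage to complex scalars -/

theorem toC_mulVec_vecToC {m : Type*} [Fintype m] (A : Matrix m m ℝ) (x : m → ℝ) :
    toC A *ᵥ vecToC x = vecToC (A *ᵥ x) := by
  ext i
  simp [Matrix.mulVec, dotProduct, vecToC]

theorem toC_pow (m : ℕ) : toC P ^ m = toC (P ^ m) :=
  (map_pow (Complex.ofRealHom.mapMatrix) P m).symm

theorem norm_vecToC (x : Fin n → ℝ) : ‖vecToC x‖ = ‖x‖ := by
  simp [Pi.norm_def]

theorem toC_pow_mulVec_vecToC (m : ℕ) (x : Fin n → ℝ) :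
    toC P ^ m *ᵥ vecToC x = vecToC ((P ^ m) *ᵥ x) := by
  rw [toC_pow, toC_mulVec_vecToC]

theorem smul_pow_mulVec (c : ℝ) (m : ℕ) (x : Fin n → ℝ) :
    ((c⁻¹ • P) ^ m) *ᵥ x = (c ^ m)⁻¹ • ((P ^ m) *ᵥ x) := by
  rw [smul_pow, Matrix.smul_mulVec, inv_pow]

/-! ### The local spectral radius -/

section LocalSpectralRadius

theorem IsSolution.localRho_lt (hP : ∀ i j, 0 ≤ P i j) (hb : 0 ≤ b) (hlam : 0 < lam)
    {x : Fin n → ℝ} (h : IsSolution P lam b x) :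
    localRho (toC P) (vecToC b) < ENNReal.ofReal lam := by
  obtain ⟨s, y, hs, hsl, hy, hby, hPy⟩ := h.exists_contracting hP hb hlam
  unfold localRho
  split_ifs with hb0
  · simpa using hlam
  -- The room between `s` and `t` absorbs the constant `‖y‖`: eventually `s ^ m * ‖y‖ ≤ t ^ m`.
  obtain ⟨t, hst, htl⟩ := exists_between hsl
  have ht : 0 < t := hs.trans hst
  refine lt_of_le_of_lt ?_ ((ENNReal.ofReal_lt_ofReal_iff hlam).2 htl)
  have hlim : Tendsto (fun m : ℕ => (s / t) ^ m * ‖y‖) atTop (𝓝 0) := by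
    have := (tendsto_pow_atTop_nhds_zero_of_lt_one (div_nonneg hs.le ht.le)
      ((div_lt_one ht).2 hst)).mul_const ‖y‖
    rwa [zero_mul] at this
  refine limsup_le_of_le (by isBoundedDefault) ?_
  filter_upwards [hlim.eventually_le_const one_pos, eventually_ge_atTop 1] with m hm hm1
  have h1 : (P ^ m) *ᵥ b ≤ s ^ m • y := by
    simpa using pow_mulVec_le_of_contracting hP hs.le hPy (C := 1) (by simpa using hby) zero_le_one m
  have h0 : 0 ≤ (P ^ m) *ᵥ b := mulVec_nonneg (pow_entry_nonneg hP m) hb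
  have h2 : ‖(P ^ m) *ᵥ b‖ ≤ t ^ m := by
    have h3 : ‖(P ^ m) *ᵥ b‖ ≤ s ^ m * ‖y‖ := by
      refine (pi_norm_le_iff_of_nonneg (by positivity)).2 fun i => ?_
      rw [Real.norm_of_nonneg (h0 i)]
      refine (h1 i).trans ?_
      exact mul_le_mul_of_nonneg_left ((le_abs_self _).trans (norm_le_pi_norm y i)) (by positivity)
    refine h3.trans ?_
    rw [div_pow, div_mul_eq_mul_div, div_le_one (by positivity)] at hm
    exact hm
  rw [toC_pow_mulVec_vecToC, ← ofReal_norm, norm_vecToC]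
  calc ENNReal.ofReal ‖(P ^ m) *ᵥ b‖ ^ (1 / (m : ℝ))
      ≤ ENNReal.ofReal (t ^ m) ^ (1 / (m : ℝ)) :=
        ENNReal.rpow_le_rpow (ENNReal.ofReal_le_ofReal h2) (by positivity)
    _ = ENNReal.ofReal t := by
        rw [ENNReal.ofReal_rpow_of_nonneg (by positivity) (by positivity), one_div,
          Real.pow_rpow_inv_natCast ht.le (by lia)]

theorem tendsto_of_localRho_lt (hlam : 0 < lam)
    (h : localRho (toC P) (vecToC b) < ENNReal.ofReal lam) :
    Tendsto (fun m : ℕ => ((lam⁻¹ • P) ^ m) *ᵥ b) atTop (𝓝 0) := by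
  unfold localRho at h
  split_ifs at h with hb0
  · have : b = 0 := by
      ext i
      simpa using congrFun hb0 i
    simp [this]
  obtain ⟨t, hlt, htl⟩ := exists_between h
  have ht : t ≠ ⊤ := (htl.trans ENNReal.ofReal_lt_top).ne
  have htl' : t.toReal < lam := by
    rwa [← ENNReal.ofReal_lt_ofReal_iff hlam, ENNReal.ofReal_toReal ht]
  have hlim : Tendsto (fun m : ℕ => (t.toReal / lam) ^ m) atTop (𝓝 0) :=
    tendsto_pow_atTop_nhds_zero_of_lt_one (by positivity) ((div_lt_one hlam).2 htl')
  refine squeeze_zero_norm' ?_ hlim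
  filter_upwards [eventually_lt_of_limsup_lt hlt (by isBoundedDefault), eventually_ge_atTop 1]
    with m hm hm1
  have hm0 : (m : ℝ) ≠ 0 := by exact_mod_cast (by lia : m ≠ 0)
  rw [toC_pow_mulVec_vecToC, ← ofReal_norm, norm_vecToC] at hm
  have h1 : ENNReal.ofReal ‖(P ^ m) *ᵥ b‖ ≤ t ^ m := by
    have := ENNReal.rpow_le_rpow hm.le (z := (m : ℝ)) (by positivity)
    rwa [← ENNReal.rpow_mul, one_div, inv_mul_cancel₀ hm0, ENNReal.rpow_one,
      ENNReal.rpow_natCast] at this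
  have h2 : ‖(P ^ m) *ᵥ b‖ ≤ t.toReal ^ m := by
    rw [← ENNReal.toReal_pow]
    exact (ENNReal.ofReal_le_iff_le_toReal (by finiteness)).1 h1
  rw [smul_pow_mulVec, norm_smul, norm_inv, Real.norm_of_nonneg (by positivity), div_pow,
    inv_mul_eq_div]
  gcongr

end LocalSpectralRadius

/-! ### Generalized eigenvectors of the transpose -/

section GeneralizedEigenvectors

theorem toC_transpose_mulVec_dotProduct (z : Fin n → ℂ) (w : Fin n → ℝ) :
    (toC Pᵀ *ᵥ z) ⬝ᵥ vecToC w = z ⬝ᵥ vecToC (P *ᵥ w) := by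
  rw [← toC_mulVec_vecToC, Matrix.dotProduct_mulVec, ← Matrix.mulVec_transpose]
  rfl

/-- Induction on `k`: `(Pᵀ - μ) z` is killed by the `k`-th power, so it annihilates the whole orbit
of `w`. Hence `⟨z, Pᵐ w⟩ = μᵐ ⟨z, w⟩`, and `|μ| ≥ lam` is incompatible with the decay of `lam⁻ᵐ Pᵐ
w` unless `⟨z, w⟩ = 0`. -/
theorem dotProduct_eq_zero_of_mem_ker_pow (hlam : 0 < lam) {μ : ℂ} (hμ : lam ≤ ‖μ‖) (k : ℕ)
    {z : Fin n → ℂ} (hz : ((Matrix.toLin' (toC Pᵀ) - μ • 1) ^ k) z = 0) {w : Fin n → ℝ}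
    (hw : Tendsto (fun m : ℕ => (lam ^ m)⁻¹ • ((P ^ m) *ᵥ w)) atTop (𝓝 0)) :
    z ⬝ᵥ vecToC w = 0 := by
  induction k generalizing z w with
  | zero =>
    have : z = 0 := by simpa using hz
    simp [this]
  | succ k ih =>
    rw [pow_succ, Module.End.mul_apply] at hz
    have hstep : ∀ m, z ⬝ᵥ vecToC ((P ^ m) *ᵥ w) = μ ^ m * (z ⬝ᵥ vecToC w) := by
      intro m
      have hD : ∀ m : ℕ,
          Tendsto (fun l : ℕ => (lam ^ l)⁻¹ • ((P ^ l) *ᵥ ((P ^ m) *ᵥ w))) atTop (𝓝 0) := by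
        intro m
        have h1 := ((tendsto_add_atTop_iff_nat m).2 hw).const_smul (lam ^ m)
        rw [smul_zero] at h1
        refine h1.congr fun l => ?_
        rw [Matrix.mulVec_mulVec, ← pow_add, smul_smul, pow_add, mul_inv, mul_left_comm,
          mul_inv_cancel₀ (pow_pos hlam m).ne', mul_one]
      induction m with
      | zero => simp
      | succ m ihm =>
        have h2 := ih hz (hD m)
        simp only [LinearMap.sub_apply, LinearMap.smul_apply, Module.End.one_apply,
          Matrix.toLin'_apply, sub_dotProduct, smul_dotProduct, smul_eq_mul,
          toC_transpose_mulVec_dotProduct] at h2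
        rw [pow_succ_mulVec, sub_eq_zero.1 h2, ihm, pow_succ]
        ring
    have hc : Continuous fun w : Fin n → ℝ => ‖z ⬝ᵥ vecToC w‖ := by
      simp only [dotProduct]
      fun_prop
    have hlim := (hc.tendsto 0).comp hw
    have h0 : ‖z ⬝ᵥ vecToC (0 : Fin n → ℝ)‖ = 0 := by simp [dotProduct, vecToC]
    rw [h0] at hlim
    have hle : ‖z ⬝ᵥ vecToC w‖ ≤ 0 := by
      refine ge_of_tendsto' hlim fun m => ?_
      have h3 : vecToC ((lam ^ m)⁻¹ • ((P ^ m) *ᵥ w))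
          = (((lam ^ m)⁻¹ : ℝ) : ℂ) • vecToC ((P ^ m) *ᵥ w) := by
        ext i
        simp [vecToC]
      simp only [Function.comp_apply]
      rw [h3, dotProduct_smul, hstep, smul_eq_mul, norm_mul, norm_mul, norm_pow, Complex.norm_real,
        Real.norm_of_nonneg (by positivity), ← mul_assoc]
      refine le_mul_of_one_le_left (norm_nonneg _) ?_
      rw [inv_mul_eq_div, one_le_div (by positivity)]
      gcongr
    simpa using hle

/-- If `i` has access to the support of `b`, the unit vector at `i` is dominated by a multiple of
some `Pˡ b` and inherits its decay. Pairing with that vector isolates `z i`, which is why `z` may be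
replaced by `|z|`. -/
theorem IsGenEigenvector.eq_zero_on_accessUnion (hP : ∀ i j, 0 ≤ P i j) (hb : 0 ≤ b)
    (hlam : 0 < lam) (hd : Tendsto (fun m : ℕ => ((lam⁻¹ • P) ^ m) *ᵥ b) atTop (𝓝 0))
    {μ : ℂ} (hμ : lam ≤ ‖μ‖) {z : Fin n → ℂ} (hz : IsGenEigenvector (toC Pᵀ) μ z) {i : Fin n}
    (hi : i ∈ accessUnion P (Function.support b)) : z i = 0 := by
  obtain ⟨k, hk⟩ := Module.End.mem_genEigenspace_top.1 hz.1
  have hw : Tendsto (fun m : ℕ => (lam ^ m)⁻¹ • ((P ^ m) *ᵥ (Pi.single i 1 : Fin n → ℝ)))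
      atTop (𝓝 0) := by
    obtain ⟨j, hj, hij⟩ := mem_accessUnion.1 hi
    obtain ⟨l, hl⟩ := exists_pow_pos_of_access hP hij
    have hbj : 0 < b j := lt_of_le_of_ne (hb j) (Ne.symm hj)
    have hpos : 0 < ((P ^ l) *ᵥ b) i := (mul_pos hl hbj).trans_le <|
      Finset.single_le_sum (f := fun j => (P ^ l) i j * b j)
        (fun j _ => mul_nonneg (pow_entry_nonneg hP l i j) (hb j)) (Finset.mem_univ j)
    obtain ⟨C, hC, hle⟩ := exists_le_smul (x := (Pi.single i 1 : Fin n → ℝ))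
      (y := (P ^ l) *ᵥ b) (mulVec_nonneg (pow_entry_nonneg hP l) hb) fun a ha => by
        have : a = i := by
          by_contra hne
          simp [hne] at ha
        rwa [this]
    simp only [smul_pow_mulVec] at hd
    have h1 := ((tendsto_add_atTop_iff_nat l).2 hd).const_smul (C * lam ^ l)
    rw [smul_zero] at h1
    have h0 : (0 : Fin n → ℝ) ≤ Pi.single i 1 := by simp
    refine tendsto_pi_nhds.2 fun a => squeeze_zero
      (fun m => mul_nonneg (by positivity) (mulVec_nonneg (pow_entry_nonneg hP m) h0 a)) (fun m => ?_) (tendsto_pi_nhds.1 h1 a)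
    have h2 := mulVec_mono (pow_entry_nonneg hP m) hle
    rw [Matrix.mulVec_smul, Matrix.mulVec_mulVec, ← pow_add] at h2
    refine (smul_le_smul_of_nonneg_left h2 (by positivity : 0 ≤ (lam ^ m)⁻¹) a).trans_eq ?_
    simp only [smul_smul]
    refine congrArg (fun c : ℝ => (c • ((P ^ (m + l)) *ᵥ b)) a) ?_
    rw [pow_add, mul_inv]
    field_simp
  have h := dotProduct_eq_zero_of_mem_ker_pow hlam hμ k (LinearMap.mem_ker.1 hk) hw
  simpa [dotProduct, vecToC, Pi.single_apply, apply_ite] using h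

theorem dotProduct_norm_eq_zero {z : Fin n → ℂ}
    (h : ∀ i ∈ accessUnion P (Function.support b), z i = 0) : (fun i => ‖z i‖) ⬝ᵥ b = 0 := by
  refine Finset.sum_eq_zero fun i _ => ?_
  by_cases hi : b i = 0
  · simp [hi]
  · simp [h i (mem_accessUnion_self hi)]

theorem dotProduct_eq_zero_of_norm (hb : 0 ≤ b) {z : Fin n → ℂ}
    (h : (fun i => ‖z i‖) ⬝ᵥ b = 0) : z ⬝ᵥ vecToC b = 0 := by
  rw [← norm_le_zero_iff, ← h]
  refine (norm_sum_le _ _).trans_eq (Finset.sum_congr rfl fun i _ => ?_)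
  rw [norm_mul, Complex.norm_real, Real.norm_of_nonneg (hb i)]

/-- A Fitting decomposition argument. Orthogonality to the generalized eigenvectors of `Pᵀ` for `r`
puts `b` in the range of `(P - r)ᴺ`. The critical eigenvector then lies in this invariant range and
in the kernel, hence is zero. -/
theorem exists_isSolution_of_dotProduct (hP : ∀ i j, 0 ≤ P i j) (hb : 0 ≤ b) (hlam : 0 < lam)
    (hf : ∀ (μ : ℝ) (z : Fin n → ℂ), IsDistinguishedEigenvalue P μ → lam ≤ μ →
      IsGenEigenvector (toC Pᵀ) (μ : ℂ) z → z ⬝ᵥ vecToC b = 0) :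
    ∃ x, IsSolution P lam b x := by
  by_contra hno
  obtain ⟨r, x, hlr, hx0, hxne, hPx, hW⟩ := exists_eigenvector_of_not_solvable hP hb hlam hno
  have hdist : IsDistinguishedEigenvalue P r :=
    ⟨x, hx0, Module.End.hasEigenvector_iff.2 ⟨Module.End.mem_eigenspace_iff.2 (by simpa using hPx), hxne⟩⟩
  set Q : Matrix (Fin n) (Fin n) ℝ := P - r • 1 with hQ
  set f : Module.End ℝ (Fin n → ℝ) := Matrix.toLin' Q with hfdef
  -- `N ≥ 1` ensures that the eigenvector, killed by `f`, is also killed by `f ^ N`.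
  obtain ⟨N, hN1, hN⟩ := ((f.eventually_disjoint_ker_pow_range_pow).and
    (eventually_ge_atTop 1)).exists.imp fun N h => h.symm
  have hfN : ∀ v, (f ^ N) v = (Q ^ N) *ᵥ v := fun v => by
    rw [hfdef, ← Matrix.toLin'_pow, Matrix.toLin'_apply]
  have hcomm : Commute P (Q ^ N) :=
    ((Commute.refl P).sub_right ((Commute.one_right P).smul_right r)).pow_right N
  have hbW : b ∈ LinearMap.range (f ^ N) := by
    by_contra hbn
    -- The vector representing a functional that vanishes on the range but not at `b` is a
    -- generalized eigenvector of the transpose not orthogonal to `b`.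
    obtain ⟨g, hgb, hg⟩ := Submodule.exists_le_ker_of_notMem hbn
    set z : Fin n → ℝ := fun i => g (Pi.single i 1) with hz
    have hgz : ∀ v, g v = z ⬝ᵥ v := by
      intro v
      rw [LinearMap.pi_apply_eq_sum_univ g v]
      simp only [dotProduct, hz, smul_eq_mul]
      refine Finset.sum_congr rfl fun i _ => ?_
      rw [mul_comm]
      congr 2
      ext j
      simp [Pi.single_apply, eq_comm]
    have hzQ : (Q ^ N)ᵀ *ᵥ z = 0 := by
      refine dotProduct_eq_zero _ fun v => ?_
      have h1 : g ((f ^ N) v) = 0 := hg ⟨v, rfl⟩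
      rw [hgz, hfN, Matrix.dotProduct_mulVec, ← Matrix.mulVec_transpose] at h1
      exact h1
    have hker : ((Matrix.toLin' (toC Pᵀ) - (r : ℂ) • 1) ^ N) (vecToC z) = 0 := by
      have h2 : Matrix.toLin' (toC Pᵀ) - (r : ℂ) • 1 = Matrix.toLin' (toC Qᵀ) := by
        have h3 : toC Qᵀ = toC Pᵀ - (r : ℂ) • 1 := by
          ext i j
          by_cases hij : i = j <;> simp [hQ, hij]
        rw [h3, map_sub, map_smul, Matrix.toLin'_one]
        rfl
      rw [h2, ← Matrix.toLin'_pow, Matrix.toLin'_apply, toC_pow_mulVec_vecToC, ← Matrix.transpose_pow,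
        hzQ]
      ext i
      simp
    have hz0 : vecToC z ≠ 0 := by
      intro h0
      apply hgb
      have : z = 0 := by
        ext i
        simpa using congrFun h0 i
      rw [hgz, this, zero_dotProduct]
    have hzb := hf r (vecToC z) hdist hlr ⟨Module.End.mem_genEigenspace_top.2 ⟨N, hker⟩, hz0⟩
    apply hgb
    rw [hgz]
    have h4 : vecToC z ⬝ᵥ vecToC b = ((z ⬝ᵥ b : ℝ) : ℂ) := by
      simp [dotProduct]
    rw [h4] at hzb
    exact_mod_cast hzb
  have hxW : x ∈ LinearMap.range (f ^ N) := by
    refine hW _ ?_ hbW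
    rintro _ ⟨v, rfl⟩
    refine ⟨P *ᵥ v, ?_⟩
    rw [hfN, hfN, Matrix.mulVec_mulVec, Matrix.mulVec_mulVec, hcomm.eq]
  have hxK : x ∈ LinearMap.ker (f ^ N) := by
    have h5 : f x = 0 := by
      rw [hfdef, Matrix.toLin'_apply, hQ, Matrix.sub_mulVec, hPx, Matrix.smul_mulVec,
        Matrix.one_mulVec, sub_self]
    obtain ⟨M, rfl⟩ := Nat.exists_eq_add_of_le' hN1
    rw [LinearMap.mem_ker, pow_succ, Module.End.mul_apply, h5, map_zero]
  exact hxne (Submodule.disjoint_def.1 hN x hxK hxW)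

end GeneralizedEigenvectors

/-! ### Spectral radii of classes and distinguished classes -/

theorem exists_minimal_of_trans {ι : Type*} [Fintype ι] {R : ι → ι → Prop} (hrefl : ∀ i, R i i)
    (htrans : ∀ i j k, R i j → R j k → R i k) {T : Set ι} (hT : T.Nonempty) :
    ∃ j ∈ T, ∀ k ∈ T, R k j → R j k := by
  classical
  obtain ⟨j, hj, hmin⟩ := T.toFinite.exists_minimalFor
    (fun j => (Finset.univ.filter fun k => R k j).card) T hT
  refine ⟨j, hj, fun k hk hkj => ?_⟩
  have hsub : (Finset.univ.filter fun l => R l k) ⊆ Finset.univ.filter fun l => R l j := by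
    intro l hl
    simp only [Finset.mem_filter, Finset.mem_univ, true_and] at hl ⊢
    exact htrans _ _ _ hl hkj
  have hEq := Finset.eq_of_subset_of_card_le hsub (hmin hk (Finset.card_le_card hsub))
  have : j ∈ Finset.univ.filter fun l => R l k := by
    rw [hEq]
    simp [hrefl]
  simpa using this

/-- The moduli of an eigenvector of the class block, extended by zero, form `q` with `‖μ‖ • q ≤ P *ᵥ
q`. The contracted vector `y` is positive on the class, so `q ≤ C • y`; comparing growth under
powers of `P` gives `‖μ‖ ≤ s < lam`. -/
theorem IsSolution.classRho_lt (hP : ∀ i j, 0 ≤ P i j) (hb : 0 ≤ b) (hlam : 0 < lam)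
    {x : Fin n → ℝ} (h : IsSolution P lam b x) {α : Finset (Fin n)} (hα : IsClass P α)
    (hacc : SetAccess P α (Function.support b)) : classRho P α < ENNReal.ofReal lam := by
  obtain ⟨s, y, hs, hsl, hy, hby, hPy⟩ := h.exists_contracting hP hb hlam
  refine lt_of_le_of_lt ?_ ((ENNReal.ofReal_lt_ofReal_iff hlam).2 hsl)
  refine iSup₂_le fun μ hμ => ?_
  rw [← Matrix.spectrum_toLin', ← Module.End.hasEigenvalue_iff_mem_spectrum] at hμ
  obtain ⟨z, hz⟩ := hμ.exists_hasEigenvector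
  have hzeq := hz.apply_eq_smul
  rw [Matrix.toLin'_apply] at hzeq
  classical
  set q : Fin n → ℝ := fun i => if h : i ∈ α then ‖z ⟨i, h⟩‖ else 0 with hq
  have hq0 : 0 ≤ q := fun i => by
    simp only [hq]
    split_ifs <;> simp
  have hqP : ‖μ‖ • q ≤ P *ᵥ q := by
    intro i
    by_cases hi : i ∈ α
    · have h1 : (P *ᵥ q) i = ∑ j : {j // j ∈ α}, P i j * ‖z j‖ := by
        have h2 : (P *ᵥ q) i = ∑ j ∈ α, P i j * q j := by
          refine (Finset.sum_subset (Finset.subset_univ α) fun j _ hj => ?_).symm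
          simp [hq, hj]
        rw [h2, ← Finset.sum_coe_sort]
        refine Finset.sum_congr rfl fun j _ => ?_
        simp [hq]
      have h3 := congrFun hzeq ⟨i, hi⟩
      rw [h1, Pi.smul_apply, smul_eq_mul]
      simp only [hq, hi, dite_true]
      rw [← norm_mul]
      simp only [Pi.smul_apply, smul_eq_mul] at h3
      rw [← h3]
      refine (norm_sum_le _ _).trans_eq (Finset.sum_congr rfl fun j _ => ?_)
      simp [abs_of_nonneg (hP i j)]
    · have : (‖μ‖ • q) i = 0 := by simp [hq, hi]
      rw [this]
      exact mulVec_nonneg hP hq0 i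
  obtain ⟨C, hC, hqy⟩ := exists_le_smul (x := q) hy fun i hi => by
    have hiα : i ∈ α := by
      by_contra hn
      simp [hq, hn] at hi
    exact pos_of_mem_accessUnion hP hb hs hy hPy zero_le_one (by simpa using hby) ⟨α, hα, hacc, hiα⟩
  obtain ⟨a, ha⟩ : ∃ a, z a ≠ 0 := by
    by_contra! hall
    exact hz.2 (funext hall)
  have hqa : 0 < q a := by simpa [hq] using ha
  have hbound : ∀ m : ℕ, (‖μ‖ / s) ^ m ≤ C * y a / q a := by
    intro m
    have h1 := (le_pow_mulVec hP (norm_nonneg μ) hqP m).trans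
      (pow_mulVec_le_of_contracting hP hs.le hPy hqy hC m) a
    simp only [Pi.smul_apply, smul_eq_mul] at h1
    rw [le_div_iff₀ hqa, div_pow, div_mul_eq_mul_div, div_le_iff₀ (by positivity)]
    linarith
  have hμs : ‖μ‖ ≤ s := by
    by_contra! hlt
    obtain ⟨m, hm⟩ := pow_unbounded_of_one_lt (C * y a / q a) ((one_lt_div hs).2 hlt)
    exact (hbound m).not_gt hm
  rw [← enorm_eq_nnnorm, ← ofReal_norm]
  exact ENNReal.ofReal_le_ofReal hμs

theorem exists_isSolution_of_classRho_lt (hP : ∀ i j, 0 ≤ P i j) (hb : 0 ≤ b) (hlam : 0 < lam)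
    (hg : ∀ α : Finset (Fin n), IsClass P α → SetAccess P α (Function.support b) →
      classRho P α < ENNReal.ofReal lam) : ∃ x, IsSolution P lam b x := by
  by_contra hno
  obtain ⟨r, x, hlr, hx0, hxne, hPx, hW⟩ := exists_eigenvector_of_not_solvable hP hb hlam hno
  have hxU := hW _ (fun w => mulVec_mem_accessSubmodule) mem_accessSubmodule_support
  have hne : (Function.support x).Nonempty := Function.support_nonempty_iff.2 hxne
  -- Access is reversed, so minimality makes the class of `a` final: every index of the support of
  -- `x` reachable from `a` reaches `a` back. The restriction of `x` to this class is therefore an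
  -- eigenvector of the block.
  obtain ⟨a, ha, hfin⟩ := exists_minimal_of_trans (R := fun i j => Access P j i)
    (fun _ => .refl) (fun i j k h1 h2 => h2.trans h1) hne
  have haU : a ∈ accessUnion P (Function.support b) := by
    by_contra hn
    exact ha (hxU a hn)
  have hlt := hg (classOf P a) isClass_classOf (setAccess_classOf.2 (mem_accessUnion.1 haU))
  refine hlt.not_ge ((ENNReal.ofReal_le_ofReal hlr).trans ?_)
  set A := P.submatrix (Subtype.val : {i // i ∈ classOf P a} → Fin n)
    (Subtype.val : {i // i ∈ classOf P a} → Fin n) with hA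
  set v : {i // i ∈ classOf P a} → ℝ := fun i => x i with hv
  have hAv : A *ᵥ v = r • v := by
    ext i
    have h1 := congrFun hPx i
    have h2 : (P *ᵥ x) i = ∑ j ∈ classOf P a, P i j * x j := by
      refine (Finset.sum_subset (Finset.subset_univ (classOf P a)) fun j _ hj => ?_).symm
      by_contra hne
      obtain ⟨h3, h4⟩ : P i j ≠ 0 ∧ x j ≠ 0 := mul_ne_zero_iff.1 hne
      have h5 : Access P a j := (mem_classOf.1 i.2).1.tail h3
      exact hj (mem_classOf.2 ⟨h5, hfin j h4 h5⟩)
    rw [h2, ← Finset.sum_coe_sort] at h1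
    exact h1
  have hmem : (r : ℂ) ∈ spectrum ℂ (toC A) := by
    rw [← Matrix.spectrum_toLin' (toC A), ← Module.End.hasEigenvalue_iff_mem_spectrum]
    refine Module.End.hasEigenvalue_of_hasEigenvector (x := vecToC v)
      (Module.End.hasEigenvector_iff.2 ⟨Module.End.mem_eigenspace_iff.2 ?_, fun h0 => ha ?_⟩)
    · rw [Matrix.toLin'_apply, toC_mulVec_vecToC, hAv]
      ext i
      simp [vecToC]
    · simpa [hv] using congrFun h0 ⟨a, self_mem_classOf⟩
  refine le_trans ?_ (le_iSup₂ (f := fun (k : ℂ) (_ : k ∈ spectrum ℂ (toC A)) => (‖k‖₊ : ℝ≥0∞))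
    (r : ℂ) hmem)
  rw [← enorm_eq_nnnorm, ← ofReal_norm, Complex.norm_real,
    Real.norm_of_nonneg (hlam.le.trans hlr)]

/-- Among the classes with access to `a`, take those of largest spectral radius, and among these one
that no other such class has access to. -/
theorem exists_distinguishedClass (a : Fin n) :
    ∃ i, Access P i a ∧ classRho P (classOf P a) ≤ classRho P (classOf P i) ∧
      IsDistinguishedClass P (classOf P i) := by
  have hTne : {i | Access P i a}.Nonempty := ⟨a, .refl⟩
  obtain ⟨m, hm, hmax⟩ := Set.exists_max_image {i | Access P i a}
    (fun i => classRho P (classOf P i)) (Set.toFinite _) hTne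
  obtain ⟨j, ⟨hja, hjm⟩, hmin⟩ := exists_minimal_of_trans (R := Access P) (fun _ => .refl)
    (fun i j k h1 h2 => h1.trans h2)
    (T := {i | Access P i a ∧ classRho P (classOf P i) = classRho P (classOf P m)}) ⟨m, hm, rfl⟩
  refine ⟨j, hja, hjm ▸ hmax a .refl, isClass_classOf, fun β hβ hne hacc => ?_⟩
  obtain ⟨k, rfl⟩ := hβ.exists_eq_classOf
  rw [setAccess_classOf_classOf] at hacc
  have hka : Access P k a := hacc.trans hja
  rw [hjm]
  refine lt_of_le_of_ne (hmax k hka) fun heq => hne ?_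
  exact isClass_classOf.eq_classOf (mem_classOf.2 ⟨hacc, hmin k ⟨hka, heq⟩ hacc⟩)

/-! ### Structure of the solution set -/

theorem support_eq_accessUnion (hP : ∀ i j, 0 ≤ P i j) (hb : 0 ≤ b) (hlam : 0 < lam)
    {x : Fin n → ℝ} (hx : HasSum (neumannTerm P lam b) x) :
    Function.support x = accessUnion P (Function.support b) := by
  have hsol := isSolution_of_hasSum hP hb hlam hx
  have heq := (isSolution_iff.1 hsol).2
  refine Set.Subset.antisymm (fun i hi => ?_) fun i hi => ?_
  · by_contra hn
    exact hi (mem_of_hasSum_neumannTerm (fun w => mulVec_mem_accessSubmodule)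
      mem_accessSubmodule_support hx i hn)
  · refine (pos_of_mem_accessUnion hP hb hlam hsol.1 ?_ hlam.le ?_ hi).ne'
    · rw [← heq]
      exact le_add_of_nonneg_right hb
    · rw [← heq]
      exact le_add_of_nonneg_left (mulVec_nonneg hP hsol.1)

theorem isDistinguishedEigenvector_iff {u : Fin n → ℝ} :
    IsDistinguishedEigenvector P lam u ↔ 0 ≤ u ∧ P *ᵥ u = lam • u ∧ u ≠ 0 := by
  unfold IsDistinguishedEigenvector
  rw [Module.End.hasEigenvector_iff, Module.End.mem_eigenspace_iff, Matrix.toLin'_apply]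

theorem IsSolution.sub_minimal (hP : ∀ i j, 0 ≤ P i j) (hb : 0 ≤ b) (hlam : 0 < lam)
    {x₀ x : Fin n → ℝ} (hx₀ : HasSum (neumannTerm P lam b) x₀) (hx : IsSolution P lam b x) :
    0 ≤ x - x₀ ∧ P *ᵥ (x - x₀) = lam • (x - x₀) := by
  have h₀ := (isSolution_iff.1 (isSolution_of_hasSum hP hb hlam hx₀)).2
  obtain ⟨x', hx', hle⟩ := hx.exists_hasSum hP hb hlam
  rw [hx'.unique hx₀] at hle
  refine ⟨sub_nonneg.2 hle, ?_⟩
  rw [Matrix.mulVec_sub, smul_sub, ← h₀, ← (isSolution_iff.1 hx).2, add_sub_add_right_eq_sub]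

/-- The difference `u = x - x₀` is fixed by `lam⁻¹ • P` and supported where `x₀` is positive. Thus
`u ≤ C • x₀`, and applying `lam⁻ᵐ Pᵐ` sends the bound to zero. -/
theorem IsSolution.eq_minimal_of_support_subset (hP : ∀ i j, 0 ≤ P i j) (hb : 0 ≤ b)
    (hlam : 0 < lam) {x₀ x : Fin n → ℝ} (hx₀ : HasSum (neumannTerm P lam b) x₀)
    (hx : IsSolution P lam b x)
    (hs : Function.support x ⊆ accessUnion P (Function.support b)) : x = x₀ := by
  obtain ⟨hu0, hPu⟩ := hx.sub_minimal hP hb hlam hx₀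
  have hx₀0 := (isSolution_of_hasSum hP hb hlam hx₀).1
  rw [← support_eq_accessUnion hP hb hlam hx₀] at hs
  obtain ⟨C, hC, hle⟩ := exists_le_smul (x := x - x₀) hx₀0 fun i hi => by
    refine lt_of_le_of_ne (hx₀0 i) fun h0 => hi ?_
    have h1 : x i = 0 := by
      by_contra hne
      exact hs hne h0.symm
    have h2 : x₀ i = 0 := h0.symm
    simp [h1, h2]
  have hlim := (tendsto_pow_mulVec_of_hasSum hP hb hlam hx₀).const_smul C
  rw [smul_zero] at hlim
  have hle0 : x - x₀ ≤ 0 := by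
    refine ge_of_tendsto' hlim fun m => ?_
    have h2 := (le_pow_mulVec hP hlam.le hPu.ge m).trans
      (mulVec_mono (pow_entry_nonneg hP m) hle)
    rw [Matrix.mulVec_smul] at h2
    have h3 := smul_le_smul_of_nonneg_left h2 (by positivity : 0 ≤ (lam ^ m)⁻¹)
    rwa [inv_smul_smul₀ (pow_pos hlam m).ne', smul_comm] at h3
  exact sub_eq_zero.1 (le_antisymm hle0 hu0)

theorem tendsto_partial_sums_of_hasSum (hlam : 0 < lam) {x : Fin n → ℝ}
    (hx : HasSum (neumannTerm P lam b) x) :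
    Tendsto (fun m : ℕ => ∑ j ∈ Finset.range (m + 1), (lam ^ j)⁻¹ • ((P ^ j) *ᵥ b))
      atTop (𝓝 (lam • x)) := by
  refine (((tendsto_add_atTop_iff_nat 1).2 hx.tendsto_sum_nat).const_smul lam).congr fun m => ?_
  rw [Finset.smul_sum]
  refine Finset.sum_congr rfl fun j _ => ?_
  rw [neumannTerm, smul_smul, pow_succ, mul_inv, mul_left_comm, mul_inv_cancel₀ hlam.ne', mul_one]

end NonnegMatrix

/-! ### The equivalences and the description of all solutions -/

theorem corollary3p3 (n : ℕ) (P : Matrix (Fin n) (Fin n) ℝ) (hP : ∀ i j, 0 ≤ P i j)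
    (b : Fin n → ℝ) (hb : 0 ≤ b) (lam : ℝ) (hlam : 0 < lam) :
    List.TFAE [
      -- (a)
      ∃ x : Fin n → ℝ, IsSolution P lam b x,
      -- (b)
      localRho (toC P) (vecToC b) < ENNReal.ofReal lam,
      -- (c)
      ∃ L : Fin n → ℝ,
        Tendsto (fun m : ℕ => ∑ j ∈ Finset.range (m + 1), (lam ^ j)⁻¹ • ((P ^ j) *ᵥ b))
          atTop (𝓝 L),
      -- (d)
      Tendsto (fun m : ℕ => ((lam⁻¹ • P) ^ m) *ᵥ b) atTop (𝓝 0),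
      -- (e)
      ∀ (μ : ℂ) (z : Fin n → ℂ), lam ≤ ‖μ‖ → IsGenEigenvector (toC Pᵀ) μ z →
        z ⬝ᵥ vecToC b = 0,
      -- (f)
      ∀ (μ : ℝ) (z : Fin n → ℂ), IsDistinguishedEigenvalue P μ → lam ≤ μ →
        IsGenEigenvector (toC Pᵀ) (μ : ℂ) z → z ⬝ᵥ vecToC b = 0,
      -- (g)
      ∀ α : Finset (Fin n), IsClass P α → SetAccess P α (Function.support b) →
        classRho P α < ENNReal.ofReal lam,
      -- (h)
      ∀ α : Finset (Fin n), IsDistinguishedClass P α → ENNReal.ofReal lam ≤ classRho P α →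
        ∀ β : Finset (Fin n), IsClass P β → SetAccess P α β → ∀ i ∈ β, b i = 0,
      -- (i)
      ∀ (μ : ℂ) (z : Fin n → ℂ), lam ≤ ‖μ‖ → IsGenEigenvector (toC Pᵀ) μ z →
        (fun i => ‖z i‖) ⬝ᵥ b = 0,
      -- (j)
      ∀ (μ : ℝ) (z : Fin n → ℂ), IsDistinguishedEigenvalue P μ → lam ≤ μ →
        IsGenEigenvector (toC Pᵀ) (μ : ℂ) z → (fun i => ‖z i‖) ⬝ᵥ b = 0] ∧
    ((∃ x : Fin n → ℝ, IsSolution P lam b x) →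
      ∃ x₀ : Fin n → ℝ,
        HasSum (fun j : ℕ => (lam ^ (j + 1))⁻¹ • ((P ^ j) *ᵥ b)) x₀ ∧
        IsSolution P lam b x₀ ∧
        Function.support x₀ = accessUnion P (Function.support b) ∧
        (∀ x : Fin n → ℝ, IsSolution P lam b x →
          Function.support x ⊆ accessUnion P (Function.support b) → x = x₀) ∧
        (¬ IsDistinguishedEigenvalue P lam →
          ∀ x : Fin n → ℝ, IsSolution P lam b x → x = x₀) ∧
        (IsDistinguishedEigenvalue P lam →
          ∀ x : Fin n → ℝ, IsSolution P lam b x ↔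
            ∃ u : Fin n → ℝ, (u = 0 ∨ IsDistinguishedEigenvector P lam u) ∧ x = x₀ + u)) := by
  have hnorm : ∀ μ : ℝ, lam ≤ μ → lam ≤ ‖(μ : ℂ)‖ := fun μ h => by
    rwa [Complex.norm_real, Real.norm_of_nonneg (hlam.le.trans h)]
  refine ⟨?_, ?_⟩
  · tfae_have 1 → 2 := fun ⟨x, hx⟩ => hx.localRho_lt hP hb hlam
    tfae_have 2 → 4 := tendsto_of_localRho_lt hlam
    tfae_have 1 → 3 := fun ⟨x, hx⟩ => by
      obtain ⟨x₀, hx₀, -⟩ := hx.exists_hasSum hP hb hlam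
      exact ⟨_, tendsto_partial_sums_of_hasSum hlam hx₀⟩
    tfae_have 3 → 4 := fun ⟨L, hL⟩ => by
      have h := ((tendsto_add_atTop_iff_nat 1).2 hL).sub hL
      rw [sub_self] at h
      refine (tendsto_add_atTop_iff_nat 1).1 (h.congr fun m => ?_)
      rw [Finset.sum_range_succ _ (m + 1), add_sub_cancel_left, smul_pow_mulVec]
    tfae_have 4 → 9 := fun hd μ z hμ hz =>
      dotProduct_norm_eq_zero fun i hi => hz.eq_zero_on_accessUnion hP hb hlam hd hμ hi
    tfae_have 9 → 10 := fun h μ z _ hμ hz => h μ z (hnorm μ hμ) hz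
    tfae_have 9 → 5 := fun h μ z hμ hz => dotProduct_eq_zero_of_norm hb (h μ z hμ hz)
    tfae_have 5 → 6 := fun h μ z _ hμ hz => h μ z (hnorm μ hμ) hz
    tfae_have 10 → 6 := fun h μ z hd hμ hz => dotProduct_eq_zero_of_norm hb (h μ z hd hμ hz)
    tfae_have 6 → 1 := exists_isSolution_of_dotProduct hP hb hlam
    tfae_have 1 → 7 := fun ⟨x, hx⟩ α hα hacc => hx.classRho_lt hP hb hlam hα hacc
    tfae_have 7 → 1 := exists_isSolution_of_classRho_lt hP hb hlam
    tfae_have 7 → 8 := fun hg α hα hle β hβ hαβ i hi => by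
      by_contra hne
      obtain ⟨k, hk, l, hl, hkl⟩ := hαβ
      exact (hg α hα.1 ⟨k, hk, i, hne, hkl.trans (hβ.access hl hi)⟩).not_ge hle
    -- A class violating (g) need not be distinguished; it is replaced by a distinguished class with
    -- access to it and at least as large a spectral radius.
    tfae_have 8 → 7 := fun hh α hα hacc => by
      by_contra! hle
      obtain ⟨a, rfl⟩ := hα.exists_eq_classOf
      obtain ⟨j, hj, haj⟩ := setAccess_classOf.1 hacc
      obtain ⟨i, hia, hρ, hdist⟩ := exists_distinguishedClass (P := P) a
      exact hj (hh _ hdist (hle.trans hρ) (classOf P j) isClass_classOf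
        (setAccess_classOf_classOf.2 (hia.trans haj)) j self_mem_classOf)
    tfae_finish
  · rintro ⟨y, hy⟩
    obtain ⟨x₀, hx₀, -⟩ := hy.exists_hasSum hP hb hlam
    have hsol := isSolution_of_hasSum hP hb hlam hx₀
    refine ⟨x₀, hx₀, hsol, support_eq_accessUnion hP hb hlam hx₀,
      fun x hx hs => hx.eq_minimal_of_support_subset hP hb hlam hx₀ hs,
      fun hnd x hx => ?_, fun _ x => ⟨fun hx => ⟨x - x₀, ?_, by abel⟩, ?_⟩⟩
    · by_contra hne
      obtain ⟨h0, h1⟩ := hx.sub_minimal hP hb hlam hx₀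
      exact hnd ⟨x - x₀, isDistinguishedEigenvector_iff.2 ⟨h0, h1, sub_ne_zero.2 hne⟩⟩
    · obtain ⟨h0, h1⟩ := hx.sub_minimal hP hb hlam hx₀
      rw [or_iff_not_imp_left]
      exact fun hne => isDistinguishedEigenvector_iff.2 ⟨h0, h1, hne⟩
    · rintro ⟨u, rfl | hu, rfl⟩
      · simpa using hsol
      · obtain ⟨hu0, hPu, -⟩ := isDistinguishedEigenvector_iff.1 hu
        rw [isSolution_iff] at hsol ⊢
        refine ⟨add_nonneg hsol.1 hu0, ?_⟩
        rw [Matrix.mulVec_add, smul_add, ← hsol.2, hPu]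
        abel
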